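/- For a metric space $(M,d)$ with a distinguished point $0$ (a pointed metric space), let $\operatorname{Lip}_0(M)$ be the Banach space of all Lipschitz functions $f\colon M\to\mathbb R$ with $f(0)=0$, with the norm $\|f\|=\sup_{x\neq y}|f(x)-f(y)|/d(x,y)$. For $\lambda>0$ let $\lambda M$ denote the pointed metric space $(M,d/\lambda,0)$. The pointed metric space $M$ is called - *homogeneous* if for all $x,y\in M$ some isometry of $M$ onto itself sends $x$ to $y$; - *doubling* if there is $D\in\mathbb N$ such that every closed ball of radius $r>0$ in $M$ can be covered by at most $D$ closed balls of radius $r/2$; - *uniformly discrete* if there is $\varepsilon>0$ with $d(x,y)\ge\varepsilon$ for all $x\ne y$ in $M$; - *$\lambda$-closed* if there is an isometric embedding $i\colon M\to\lambda M$ with $i(0)=0$. A pair $(X,\mathbb X)$ of pointed metric spaces is a *good pair* if there are positive reals $(r_n)_{n\ge1}$ and bi-Lipschitz embeddings $i_n\colon r_nX\to\mathbb X$ with $i_n(0)=0$ and $\sup_n\max\{\operatorname{Lip}(i_n),\operatorname{Lip}(i_n^{-1})\}<\infty$ such that for every $x\in\mathbb X$ there is a sequence $(x_n)$ in $X$ with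 $i_n(x_n)\to x$. **Theorem.** Let $\mathbb X$ be a pointed homogeneous doubling metric space and let $X\subset\mathbb X$ be a subset with the restricted metric and with a distinguished point (for instance that of $\mathbb X$, if it lies in $X$) such that $(X,\mathbb X)$ is a good pair. Suppose that either $X$ is uniformly discrete and $\lambda$-closed for some $\lambda>1$, or $X$ is homogeneous and unbounded. Then $\operatorname{Lip}_0(\mathbb X)$ and $\operatorname{Lip}_0(X)$ are linearly isomorphic, that is, there is a bounded linear bijection between them with bounded inverse. -/

import Mathlib

open Filter Topology

noncomputable section

/-- The real-valued Lipschitz functions on `M` vanishing at the base point `o`, as a vector space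
of functions. -/
def lipZeroSubmodule (M : Type*) [MetricSpace M] (o : M) : Submodule ℝ (M → ℝ) where
  carrier := {f | f o = 0 ∧ ∃ C : ℝ, ∀ x y, |f x - f y| ≤ C * dist x y}
  zero_mem' := ⟨rfl, 0, fun x y => by simp⟩
  add_mem' := by
    rintro f g ⟨hf, C, hC⟩ ⟨hg, D, hD⟩
    refine ⟨by simp [hf, hg], C + D, fun x y => ?_⟩
    calc |(f + g) x - (f + g) y| = |(f x - f y) + (g x - g y)| := by
          congr 1; simp only [Pi.add_apply]; ring
      _ ≤ |f x - f y| + |g x - g y| := abs_add_le _ _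
      _ ≤ (C + D) * dist x y := by linarith [hC x y, hD x y]
  smul_mem' := by
    rintro c f ⟨hf, C, hC⟩
    refine ⟨by simp [hf], |c| * C, fun x y => ?_⟩
    calc |(c • f) x - (c • f) y| = |c| * |f x - f y| := by
          rw [← abs_mul]; congr 1; simp only [Pi.smul_apply, smul_eq_mul]; ring
      _ ≤ |c| * (C * dist x y) := mul_le_mul_of_nonneg_left (hC x y) (abs_nonneg c)
      _ = |c| * C * dist x y := by ring

/-- The space `Lip₀(M)` of the pointed metric space `(M, o)`. It is a type of its own so that it
carries the Lipschitz norm below, and not the topology of pointwise convergence. -/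
def LipZero (M : Type*) [MetricSpace M] (o : M) : Type _ := lipZeroSubmodule M o

namespace LipZero

variable {M : Type*} [MetricSpace M] {o : M}

instance : AddCommGroup (LipZero M o) := inferInstanceAs (AddCommGroup (lipZeroSubmodule M o))

instance : Module ℝ (LipZero M o) := inferInstanceAs (Module ℝ (lipZeroSubmodule M o))

instance : CoeFun (LipZero M o) (fun _ => M → ℝ) := ⟨fun f => f.1⟩

theorem add_apply (f g : LipZero M o) (x : M) : (f + g) x = f x + g x := rfl

theorem smul_apply (c : ℝ) (f : LipZero M o) (x : M) : (c • f) x = c * f x := rfl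

theorem zero_apply (x : M) : (0 : LipZero M o) x = 0 := rfl

theorem apply_base (f : LipZero M o) : f o = 0 := f.2.1

theorem ext_apply {f g : LipZero M o} (h : ∀ x, f x = g x) : f = g := Subtype.ext (funext h)

/-- The norm `‖f‖ = sup_{x ≠ y} |f x - f y| / d(x, y)` (equal to `0` if `M` is a single point). -/
instance : Norm (LipZero M o) :=
  ⟨fun f => ⨆ p : {p : M × M // p.1 ≠ p.2}, |f p.1.1 - f p.1.2| / dist p.1.1 p.1.2⟩

theorem norm_def (f : LipZero M o) :
    ‖f‖ = ⨆ p : {p : M × M // p.1 ≠ p.2}, |f p.1.1 - f p.1.2| / dist p.1.1 p.1.2 := rfl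

theorem norm_nonneg' (f : LipZero M o) : 0 ≤ ‖f‖ := by
  rw [norm_def]
  exact Real.iSup_nonneg fun p => by positivity

theorem abs_sub_le (f : LipZero M o) (x y : M) : |f x - f y| ≤ ‖f‖ * dist x y := by
  rcases eq_or_ne x y with rfl | h
  · simp
  · obtain ⟨C, hC⟩ := f.2.2
    have hb : BddAbove (Set.range fun p : {p : M × M // p.1 ≠ p.2} =>
        |f p.1.1 - f p.1.2| / dist p.1.1 p.1.2) := by
      refine ⟨C, ?_⟩
      rintro _ ⟨p, rfl⟩
      exact (div_le_iff₀ (dist_pos.2 p.2)).2 (hC _ _)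
    have := le_ciSup hb ⟨(x, y), h⟩
    exact (div_le_iff₀ (dist_pos.2 h)).1 this

theorem norm_le {f : LipZero M o} {C : ℝ} (hC : 0 ≤ C)
    (h : ∀ x y, |f x - f y| ≤ C * dist x y) : ‖f‖ ≤ C := by
  rw [norm_def]
  exact Real.iSup_le (fun p => (div_le_iff₀ (dist_pos.2 p.2)).2 (h _ _)) hC

theorem norm_core : NormedSpace.Core ℝ (LipZero M o) where
  norm_nonneg := norm_nonneg'
  norm_smul c f := by
    have h1 : ∀ (c : ℝ) (f : LipZero M o), ‖c • f‖ ≤ |c| * ‖f‖ := fun c f => by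
      refine norm_le (mul_nonneg (abs_nonneg c) (norm_nonneg' f)) fun x y => ?_
      rw [smul_apply, smul_apply, ← mul_sub, abs_mul, mul_assoc]
      exact mul_le_mul_of_nonneg_left (abs_sub_le f x y) (abs_nonneg c)
    refine le_antisymm (h1 c f) ?_
    rcases eq_or_ne c 0 with rfl | hc
    · simpa using norm_nonneg' ((0 : ℝ) • f)
    · have h2 := h1 c⁻¹ (c • f)
      rw [inv_smul_smul₀ hc, abs_inv] at h2
      rw [Real.norm_eq_abs]
      have hc' : 0 < |c| := abs_pos.2 hc
      calc |c| * ‖f‖ ≤ |c| * (|c|⁻¹ * ‖c • f‖) := mul_le_mul_of_nonneg_left h2 hc'.le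
        _ = ‖c • f‖ := by field_simp
  norm_triangle f g := by
    refine norm_le (add_nonneg (norm_nonneg' f) (norm_nonneg' g)) fun x y => ?_
    rw [add_apply, add_apply, add_sub_add_comm, add_mul]
    exact (abs_add_le _ _).trans (add_le_add (abs_sub_le f x y) (abs_sub_le g x y))
  norm_eq_zero_iff f := by
    constructor
    · intro h
      refine ext_apply fun x => ?_
      have := abs_sub_le f x o
      rw [h, zero_mul, apply_base, sub_zero] at this
      exact abs_nonpos_iff.1 this
    · rintro rfl
      exact le_antisymm (norm_le le_rfl fun x y => by simp [zero_apply]) (norm_nonneg' _)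

instance : NormedAddCommGroup (LipZero M o) := NormedAddCommGroup.ofCore norm_core

instance : NormedSpace ℝ (LipZero M o) := NormedSpace.ofCore norm_core

end LipZero

/-- The distance `d(x, y) / lam` of the `lam`-rescaling `lam M` of the metric space `M`. -/
def rescaledDist {M : Type*} [MetricSpace M] (lam : ℝ) (x y : M) : ℝ := dist x y / lam

/-- The pair of pointed metric spaces `((X, p), (M, o))` is a good pair: there are `r n > 0` and
bi-Lipschitz embeddings `i n` of the rescaled spaces `(r n) X` into `M`, with `K` a common Lipschitz
constant of all the `i n` and of all their inverses, sending `p` to `o`, such that every point of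
`M` is the limit of some sequence `i n (u n)`. -/
def IsGoodPair {X M : Type*} [MetricSpace X] [MetricSpace M] (p : X) (o : M) : Prop :=
  ∃ (r : ℕ → ℝ) (i : ℕ → X → M) (K : ℝ),
    (∀ n, 0 < r n) ∧
    (∀ n x y, dist (i n x) (i n y) ≤ K * rescaledDist (r n) x y) ∧
    (∀ n x y, rescaledDist (r n) x y ≤ K * dist (i n x) (i n y)) ∧
    (∀ n, i n p = o) ∧
    ∀ x : M, ∃ u : ℕ → X, Tendsto (fun n => i n (u n)) atTop (𝓝 x)

/-- Every closed ball of radius `r > 0` is covered by at most `D` closed balls of radius `r / 2`. -/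
def IsDoublingSpace (M : Type*) [MetricSpace M] : Prop :=
  ∃ D : ℕ, ∀ (x : M) (r : ℝ), 0 < r → ∃ t : Finset M, t.card ≤ D ∧
    Metric.closedBall x r ⊆ ⋃ y ∈ t, Metric.closedBall y (r / 2)

/-- For all `x`, `y` some isometry of `M` onto itself sends `x` to `y`. -/
def IsHomogeneousSpace (M : Type*) [MetricSpace M] : Prop :=
  ∀ x y : M, ∃ e : M ≃ᵢ M, e x = y

def IsUniformlyDiscrete (M : Type*) [MetricSpace M] : Prop :=
  ∃ ε : ℝ, 0 < ε ∧ ∀ x y : M, x ≠ y → ε ≤ dist x y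

/-- There is an isometric embedding of `(M, o)` into its rescaling `lam M` that fixes `o`. -/
def IsScaleClosed {M : Type*} [MetricSpace M] (o : M) (lam : ℝ) : Prop :=
  ∃ i : M → M, (∀ x y, rescaledDist lam (i x) (i y) = dist x y) ∧ i o = o

end

/-!
Write `A` for `LipZero X p`, `B` for `LipZero M o`, and `ℕ →ᵇ A` for the space of bounded sequences
in `A`. By Pełczyński's decomposition method (`nonempty_equiv_of_isComplementedIn`) both `A` and `B`
are isomorphic to `ℕ →ᵇ A` as soon as `B` is complemented in `ℕ →ᵇ A`, `A` in `B`, and `ℕ →ᵇ A`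
in `A` (`nonempty_equiv_of_isComplementedIn_seq`).

* `B` in `ℕ →ᵇ A` (`IsGoodPair.isComplementedIn`): a function `f` on `M` is sent to the sequence of
  the functions `r n • (f ∘ i n)`, and `f x` is recovered as a limit of values of these functions,
  because `x` is the limit of the points `i n (u n)`. To have a linear left inverse on all bounded
  sequences, limits are taken along an ultrafilter (`exists_ultralimit_operator`).
* `A` in `B` (`IsDoublingSpace.isComplementedIn_subset`): restriction to `X` has a bounded linear
  right inverse, since in a doubling space there is a bounded linear extension operator for
  Lipschitz functions on any nonempty subset `Y` (`exists_extension_operator`). At the point `x` the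
  extension averages the given values over net points of `Y` at distance comparable to
  `infDist x Y + δ`; the averaging weights come from nets at all dyadic scales, doubling bounds the
  number of weights active at a point, and `δ → 0` along an ultrafilter.
* `ℕ →ᵇ A` in `A` (`isComplementedIn_seq_of_separated_copies`): a function in `A` is an ultralimit of
  its restrictions to growing balls about `p`. So it is enough that `X` contains (rescaled)
  copies of all these balls, each repeated infinitely often, so far apart that Lipschitz functions
  prescribed on the separate copies form one Lipschitz function on their union; the latter is
  extended to `X` linearly. If `X` is uniformly discrete and scale-closed, the copies are images
  under high iterates of the scaling map, all containing `p` but otherwise lying in distant annuli.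
  If `X` is homogeneous and unbounded, they are images under isometries moving `p` far away.
-/

noncomputable section

open BoundedContinuousFunction Metric Set

/-! ### Bounded sequences and the decomposition method -/

section Decomposition

variable {V W : Type*} [NormedAddCommGroup V] [NormedSpace ℝ V]
  [NormedAddCommGroup W] [NormedSpace ℝ W]

/-- A uniformly bounded sequence of operators `V → W`, as one operator from `V` to the space
`ℕ →ᵇ W` of bounded sequences in `W` (on the discrete space `ℕ` continuity is no condition). -/
def boundedSeqMap (T : ℕ → V →L[ℝ] W) (C : ℝ) (h : ∀ n v, ‖T n v‖ ≤ C * ‖v‖) :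
    V →L[ℝ] (ℕ →ᵇ W) :=
  LinearMap.mkContinuous
    { toFun := fun v => ofNormedAddCommGroupDiscrete (fun n => T n v) (C * ‖v‖) fun n => h n v
      map_add' := fun v w => by ext n; simp
      map_smul' := fun c v => by ext n; simp }
    C fun v => by
      have h0 : 0 ≤ C * ‖v‖ := (norm_nonneg _).trans (h 0 v)
      exact (norm_le h0).2 fun n => h n v

@[simp]
theorem boundedSeqMap_apply (T : ℕ → V →L[ℝ] W) (C : ℝ) (h : ∀ n v, ‖T n v‖ ≤ C * ‖v‖)
    (v : V) (n : ℕ) : boundedSeqMap T C h v n = T n v := rfl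

theorem norm_evalCLM_apply_le (n : ℕ) (v : ℕ →ᵇ V) : ‖evalCLM ℝ n v‖ ≤ 1 * ‖v‖ := by
  rw [one_mul]; exact v.norm_coe_le_norm n

/-- Composition of bounded sequences with a map of the index set. -/
def reindexSeq (σ : ℕ → ℕ) : (ℕ →ᵇ V) →L[ℝ] (ℕ →ᵇ V) :=
  boundedSeqMap (fun n => evalCLM ℝ (σ n)) 1 fun n => norm_evalCLM_apply_le (σ n)

@[simp]
theorem reindexSeq_apply (σ : ℕ → ℕ) (v : ℕ →ᵇ V) (n : ℕ) : reindexSeq σ v n = v (σ n) := rfl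

theorem nonempty_seq_congr (e : V ≃L[ℝ] W) : Nonempty ((ℕ →ᵇ V) ≃L[ℝ] (ℕ →ᵇ W)) :=
  ⟨ContinuousLinearEquiv.equivOfInverse
    ((e : V →L[ℝ] W).compLeftContinuousBounded ℕ)
    ((e.symm : W →L[ℝ] V).compLeftContinuousBounded ℕ)
    (fun v => by ext n; simp) (fun v => by ext n; simp)⟩

variable (V W) in
theorem nonempty_seq_prod : Nonempty ((ℕ →ᵇ (V × W)) ≃L[ℝ] ((ℕ →ᵇ V) × (ℕ →ᵇ W))) :=
  ⟨ContinuousLinearEquiv.equivOfInverse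
    (((ContinuousLinearMap.fst ℝ V W).compLeftContinuousBounded ℕ).prod
      ((ContinuousLinearMap.snd ℝ V W).compLeftContinuousBounded ℕ))
    (((ContinuousLinearMap.inl ℝ V W).compLeftContinuousBounded ℕ).coprod
      ((ContinuousLinearMap.inr ℝ V W).compLeftContinuousBounded ℕ))
    (fun v => by ext n <;> simp) (fun v => by ext n <;> simp)⟩

variable (V) in
theorem nonempty_prod_seq : Nonempty ((V × (ℕ →ᵇ V)) ≃L[ℝ] (ℕ →ᵇ V)) :=
  ⟨ContinuousLinearEquiv.equivOfInverse
    (boundedSeqMap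
      (fun n => Nat.casesOn n (ContinuousLinearMap.fst ℝ V (ℕ →ᵇ V))
        fun k => (evalCLM ℝ k).comp (ContinuousLinearMap.snd ℝ V (ℕ →ᵇ V))) 1
      (by
        rintro (_ | n) v
        · rw [one_mul]; exact norm_fst_le v
        · rw [one_mul]; exact (v.2.norm_coe_le_norm n).trans (norm_snd_le v)))
    ((evalCLM ℝ 0).prod (reindexSeq Nat.succ))
    (fun v => by ext n <;> simp [evalCLM]) (fun v => by ext (_ | n) <;> simp [evalCLM])⟩

variable (V) in
theorem nonempty_seq_seq : Nonempty ((ℕ →ᵇ V) ≃L[ℝ] (ℕ →ᵇ (ℕ →ᵇ V))) :=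
  ⟨ContinuousLinearEquiv.equivOfInverse
    (boundedSeqMap (fun k => reindexSeq fun n => Nat.pair k n) 1 fun k v => by
      refine (norm_le (by positivity)).2 fun n => ?_
      exact norm_evalCLM_apply_le (Nat.pair k n) v)
    (boundedSeqMap (fun j => (evalCLM ℝ j.unpair.2).comp (evalCLM ℝ j.unpair.1)) 1 fun j v => by
      rw [one_mul]
      exact ((v j.unpair.1).norm_coe_le_norm _).trans (v.norm_coe_le_norm _))
    (fun v => by ext n; simp [evalCLM]) (fun v => by ext k n; simp [evalCLM])⟩

/-- `V` is isomorphic to a complemented subspace of `W`: the identity of `V` factors through `W`. -/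
def IsComplementedIn (V W : Type*) [NormedAddCommGroup V] [NormedSpace ℝ V]
    [NormedAddCommGroup W] [NormedSpace ℝ W] : Prop :=
  ∃ (T : V →L[ℝ] W) (S : W →L[ℝ] V), ∀ v, S (T v) = v

theorem IsComplementedIn.trans {U : Type*} [NormedAddCommGroup U] [NormedSpace ℝ U]
    (h : IsComplementedIn U V) (h' : IsComplementedIn V W) : IsComplementedIn U W := by
  obtain ⟨T, S, hST⟩ := h
  obtain ⟨T', S', hST'⟩ := h'
  exact ⟨T'.comp T, S.comp S', fun u => by simp [hST, hST']⟩

variable (V) in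
theorem isComplementedIn_seq : IsComplementedIn V (ℕ →ᵇ V) :=
  ⟨boundedSeqMap (fun _ => ContinuousLinearMap.id ℝ V) 1 (by simp), evalCLM ℝ 0,
    fun v => rfl⟩

theorem IsComplementedIn.exists_equiv_prod_ker (h : IsComplementedIn V W) :
    ∃ S : W →L[ℝ] V, Nonempty (W ≃L[ℝ] V × LinearMap.ker (S : W →ₗ[ℝ] V)) := by
  obtain ⟨T, S, hST⟩ := h
  exact ⟨S, ⟨ContinuousLinearEquiv.equivOfRightInverse S T hST⟩⟩

/-- Pełczyński's decomposition method: if `W` is isomorphic to the space of bounded sequences in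
`W`, then every `V` such that `V` and `W` are complemented in each other is isomorphic to `W`.
Both spaces turn out to be isomorphic to `V × W`. -/
theorem nonempty_equiv_of_isComplementedIn (hW : Nonempty (W ≃L[ℝ] (ℕ →ᵇ W)))
    (h₁ : IsComplementedIn V W) (h₂ : IsComplementedIn W V) : Nonempty (V ≃L[ℝ] W) := by
  obtain ⟨eW⟩ := hW
  obtain ⟨S, ⟨e₁⟩⟩ := h₁.exists_equiv_prod_ker
  obtain ⟨R, ⟨e₂⟩⟩ := h₂.exists_equiv_prod_ker
  obtain ⟨a₁⟩ := nonempty_seq_congr e₁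
  obtain ⟨a₂⟩ := nonempty_seq_prod V (LinearMap.ker (S : W →ₗ[ℝ] V))
  obtain ⟨a₃⟩ := nonempty_prod_seq V
  obtain ⟨a₄⟩ := nonempty_prod_seq W
  let b := a₁.trans a₂
  have f₁ : W ≃L[ℝ] V × W :=
    (eW.trans b).trans <| ((a₃.symm.prodCongr (.refl ℝ _)).trans
      (ContinuousLinearEquiv.prodAssoc ℝ _ _ _)).trans
      ((ContinuousLinearEquiv.refl ℝ V).prodCongr (eW.trans b).symm)
  have f₂ : W ≃L[ℝ] W × W :=
    eW.trans (a₄.symm.trans ((ContinuousLinearEquiv.refl ℝ W).prodCongr eW.symm))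
  have f₃ : V ≃L[ℝ] W × V :=
    e₂.trans <| ((f₂.prodCongr (.refl ℝ _)).trans
      (ContinuousLinearEquiv.prodAssoc ℝ _ _ _)).trans
      ((ContinuousLinearEquiv.refl ℝ W).prodCongr e₂.symm)
  exact ⟨f₃.trans ((ContinuousLinearEquiv.prodComm ℝ W V).trans f₁.symm)⟩

/-- If bounded sequences in `V` embed as a complemented subspace of `V`, then the decomposition
method identifies with `ℕ →ᵇ V` every `W` that lies between `V` and `ℕ →ᵇ V`. -/
theorem nonempty_equiv_of_isComplementedIn_seq (hV : IsComplementedIn (ℕ →ᵇ V) V)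
    (hVW : IsComplementedIn V W) (hW : IsComplementedIn W (ℕ →ᵇ V)) : Nonempty (W ≃L[ℝ] V) := by
  obtain ⟨e₁⟩ := nonempty_equiv_of_isComplementedIn (nonempty_seq_seq V) hW (hV.trans hVW)
  obtain ⟨e₂⟩ :=
    nonempty_equiv_of_isComplementedIn (nonempty_seq_seq V) (isComplementedIn_seq V) hV
  exact ⟨e₁.trans e₂.symm⟩

end Decomposition

/-! ### Operators into Lipschitz spaces as ultralimits -/

theorem exists_tendsto_hyperfilter {u : ℕ → ℝ} {C : ℝ} (h : ∀ n, |u n| ≤ C) :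
    ∃ l, Tendsto u (hyperfilter ℕ) (𝓝 l) := by
  obtain ⟨l, -, hl⟩ := (isCompact_closedBall (0 : ℝ) C).ultrafilter_le_nhds
    ((hyperfilter ℕ).map u) (by
      refine le_principal_iff.2 (Filter.mem_map.2 (univ_mem' fun n => ?_))
      simpa using h n)
  exact ⟨l, hl⟩

/-- A sequence of linear maps `T n` from `V` to the functions on `M`, Lipschitz in the limit and
vanishing at `o` in the limit, has a pointwise limit along an ultrafilter, and this limit is a
bounded operator into `LipZero M o`. -/
theorem exists_ultralimit_operator {V M : Type*} [NormedAddCommGroup V] [NormedSpace ℝ V]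
    [MetricSpace M] {o : M} (T : ℕ → V →ₗ[ℝ] (M → ℝ)) (b : ℕ → M → M → ℝ) {C : ℝ} (hC : 0 ≤ C)
    (hb : ∀ x y, Tendsto (fun n => b n x y) atTop (𝓝 (C * dist x y)))
    (hT : ∀ n v x y, |T n v x - T n v y| ≤ b n x y * ‖v‖)
    (h₀ : ∀ v, Tendsto (fun n => T n v o) atTop (𝓝 0)) :
    ∃ S : V →L[ℝ] LipZero M o, (∀ v, ‖S v‖ ≤ C * ‖v‖) ∧
      ∀ v x, Tendsto (fun n => T n v x) (hyperfilter ℕ) (𝓝 (S v x)) := by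
  have hU : (hyperfilter ℕ : Filter ℕ) ≤ atTop := Nat.hyperfilter_le_atTop
  have hex : ∀ v x, ∃ l, Tendsto (fun n => T n v x) (hyperfilter ℕ) (𝓝 l) := by
    intro v x
    obtain ⟨B, hB⟩ := ((h₀ v).abs.add ((hb x o).mul_const ‖v‖)).bddAbove_range
    refine exists_tendsto_hyperfilter (C := B) fun n => ?_
    calc |T n v x| = |T n v o + (T n v x - T n v o)| := by ring_nf
      _ ≤ |T n v o| + |T n v x - T n v o| := abs_add_le _ _
      _ ≤ |T n v o| + b n x o * ‖v‖ := by gcongr; exact hT n v x o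
      _ ≤ B := hB ⟨n, rfl⟩
  choose L hL using hex
  have hlip : ∀ v x y, |L v x - L v y| ≤ C * ‖v‖ * dist x y := by
    intro v x y
    have h1 := ((hL v x).sub (hL v y)).abs
    have h2 := ((hb x y).mul_const ‖v‖).mono_left hU
    have := le_of_tendsto_of_tendsto' h1 h2 fun n => hT n v x y
    linarith
  refine ⟨LinearMap.mkContinuous
    { toFun := fun v => (⟨L v, tendsto_nhds_unique (hL v o) ((h₀ v).mono_left hU), C * ‖v‖,
        hlip v⟩ : lipZeroSubmodule M o)
      map_add' := fun v w => LipZero.ext_apply fun x => ?_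
      map_smul' := fun c v => LipZero.ext_apply fun x => ?_ } C fun v => ?_,
    fun v => LipZero.norm_le (by positivity) (hlip v), fun v x => hL v x⟩
  · refine tendsto_nhds_unique (hL (v + w) x) ?_
    simpa using! (hL v x).add (hL w x)
  · refine tendsto_nhds_unique (hL (c • v) x) ?_
    simpa using! (hL v x).const_mul c
  · exact LipZero.norm_le (by positivity) (hlip v)

/-! ### Nets in doubling spaces -/

theorem exists_finset_cover_div_two_pow {M : Type*} [MetricSpace M] {D : ℕ}
    (hD : ∀ (x : M) (r : ℝ), 0 < r → ∃ t : Finset M, t.card ≤ D ∧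
      closedBall x r ⊆ ⋃ y ∈ t, closedBall y (r / 2)) (m : ℕ) (x : M) {r : ℝ} (hr : 0 < r) :
    ∃ t : Finset M, t.card ≤ D ^ m ∧ closedBall x r ⊆ ⋃ y ∈ t, closedBall y (r / 2 ^ m) := by
  classical
  induction m with
  | zero => exact ⟨{x}, by simp, by simp⟩
  | succ m ih =>
    obtain ⟨t, ht, hc⟩ := ih
    choose u hu hcu using fun y => hD y (r / 2 ^ m) (by positivity)
    refine ⟨t.biUnion u, ?_, ?_⟩
    · calc (t.biUnion u).card ≤ t.card * D := Finset.card_biUnion_le_card_mul _ _ _ fun y _ => hu y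
        _ ≤ D ^ m * D := by gcongr
        _ = D ^ (m + 1) := (pow_succ _ _).symm
    · intro z hz
      obtain ⟨y, hy, hzy⟩ := mem_iUnion₂.1 (hc hz)
      obtain ⟨w, hw, hzw⟩ := mem_iUnion₂.1 (hcu y hzy)
      refine mem_iUnion₂.2 ⟨w, Finset.mem_biUnion.2 ⟨y, hy, hw⟩, ?_⟩
      rwa [pow_succ, ← div_div]

/-- In a doubling space, the number of points of a `ρ`-separated set in a ball of radius `8 * ρ` is
bounded independently of `ρ`: it is covered by `D ^ 5` balls of radius `ρ / 4`, and each of them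
contains at most one of the points. -/
theorem exists_finset_of_pairwise_lt_dist {M : Type*} [MetricSpace M] {D : ℕ}
    (hD : ∀ (x : M) (r : ℝ), 0 < r → ∃ t : Finset M, t.card ≤ D ∧
      closedBall x r ⊆ ⋃ y ∈ t, closedBall y (r / 2)) {N : Set M} {ρ : ℝ} (hρ : 0 < ρ)
    (hN : N.Pairwise fun y z => ρ < dist y z) (x : M) :
    ∃ t : Finset M, t.card ≤ D ^ 5 ∧ ∀ y ∈ N, dist x y ≤ 8 * ρ → y ∈ t := by
  classical
  obtain ⟨t, ht, hc⟩ := exists_finset_cover_div_two_pow hD 5 x (r := 8 * ρ) (by positivity)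
  have hex : ∀ w : M, ∃ v : M, ∀ y ∈ N, y ∈ closedBall w (8 * ρ / 2 ^ 5) → y = v := by
    intro w
    by_cases h : ∃ v ∈ N, v ∈ closedBall w (8 * ρ / 2 ^ 5)
    · obtain ⟨v, hv, hvw⟩ := h
      refine ⟨v, fun y hy hyw => by_contra fun hne => ?_⟩
      have h1 := hN hy hv hne
      have h2 := dist_triangle_right y v w
      rw [mem_closedBall] at hvw hyw
      linarith
    · exact ⟨w, fun y hy hyw => (h ⟨y, hy, hyw⟩).elim⟩
  choose v hv using hex
  refine ⟨t.image v, Finset.card_image_le.trans ht, fun y hy hxy => ?_⟩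
  obtain ⟨w, hw, hyw⟩ := mem_iUnion₂.1 (hc (mem_closedBall'.2 hxy))
  exact Finset.mem_image.2 ⟨w, hw, (hv w y hy hyw).symm⟩

theorem exists_maximal_separated {M : Type*} [MetricSpace M] (S : Set M) {ρ : ℝ} (hρ : 0 ≤ ρ) :
    ∃ N ⊆ S, N.Pairwise (fun y z => ρ < dist y z) ∧ ∀ y ∈ S, ∃ z ∈ N, dist y z ≤ ρ := by
  obtain ⟨N, hN⟩ := zorn_subset {N : Set M | N ⊆ S ∧ N.Pairwise fun y z => ρ < dist y z} (by
    intro c hc hchain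
    refine ⟨⋃₀ c, ⟨sUnion_subset fun s hs => (hc hs).1, ?_⟩, fun s hs => subset_sUnion_of_mem hs⟩
    exact (pairwise_sUnion hchain.directedOn).2 fun s hs => (hc hs).2)
  refine ⟨N, hN.prop.1, hN.prop.2, fun y hy => ?_⟩
  by_contra! h
  have hy' : y ∈ N := hN.le_of_ge (y := insert y N)
    ⟨insert_subset hy hN.prop.1, hN.prop.2.insert fun z hz _ =>
      ⟨h z hz, by rw [dist_comm]; exact h z hz⟩⟩ (subset_insert y N) (mem_insert y N)
  simpa [hρ.not_gt] using h y hy'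

/-! ### Linear extension of Lipschitz functions -/

/-- A system of weights on `M` for averaging values prescribed at the points `c k`: at the point
`x`, the weight `weight i x` is put on the value at the point `c (idx i)`. The weights are
`1`-Lipschitz, at most `N` of them are nonzero at a given point `x`, they only charge points within
distance `8 * s x` of `x`, and their total mass at `x` is at least `s x / 2`. -/
structure ScaledWeights {M ι : Type*} [MetricSpace M] (c : ι → M) (s : M → ℝ) (N : ℕ)
    (I : Type*) where
  idx : I → ι
  weight : I → M → ℝ
  supp : M → Finset I
  nonneg : ∀ i x, 0 ≤ weight i x
  abs_sub_le : ∀ i x y, |weight i x - weight i y| ≤ dist x y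
  mem_supp : ∀ i x, weight i x ≠ 0 → i ∈ supp x
  card_supp_le : ∀ x, (supp x).card ≤ N
  dist_le : ∀ i x, weight i x ≠ 0 → dist x (c (idx i)) ≤ 8 * s x
  le_sum : ∀ x, s x / 2 ≤ ∑ i ∈ supp x, weight i x

namespace ScaledWeights

variable {M ι I : Type*} [MetricSpace M] {c : ι → M} {s : M → ℝ} {N : ℕ}

/-- The total mass of the weights at `x`. -/
def total (w : ScaledWeights c s N I) (x : M) : ℝ := ∑ i ∈ w.supp x, w.weight i x

/-- The weighted averages of a family of values, as a linear function of the family. -/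
def average (w : ScaledWeights c s N I) : (ι → ℝ) →ₗ[ℝ] (M → ℝ) where
  toFun h x := ∑ i ∈ w.supp x, w.weight i x / w.total x * h (w.idx i)
  map_add' h g := by
    ext x
    simp [mul_add, Finset.sum_add_distrib]
  map_smul' a h := by
    ext x
    simp [Finset.mul_sum, mul_left_comm]

variable (w : ScaledWeights c s N I)

theorem total_eq_sum {x : M} {G : Finset I} (hG : w.supp x ⊆ G) :
    w.total x = ∑ i ∈ G, w.weight i x :=
  Finset.sum_subset hG fun i _ hi => by_contra fun h => hi (w.mem_supp i x h)

theorem total_pos (hs : ∀ x, 0 < s x) (x : M) : 0 < w.total x :=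
  (half_pos (hs x)).trans_le (w.le_sum x)

theorem sum_weight_div_total (hs : ∀ x, 0 < s x) {x : M} {G : Finset I} (hG : w.supp x ⊆ G) :
    ∑ i ∈ G, w.weight i x / w.total x = 1 := by
  rw [← Finset.sum_div, ← w.total_eq_sum hG, div_self (w.total_pos hs x).ne']

theorem average_sub (hs : ∀ x, 0 < s x) (h : ι → ℝ) (a : ℝ) {x : M} {G : Finset I}
    (hG : w.supp x ⊆ G) :
    w.average h x - a = ∑ i ∈ G, w.weight i x / w.total x * (h (w.idx i) - a) := by
  have h1 : w.average h x = ∑ i ∈ G, w.weight i x / w.total x * h (w.idx i) := by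
    refine Finset.sum_subset hG fun i _ hi => ?_
    have : w.weight i x = 0 := by_contra fun h => hi (w.mem_supp i x h)
    simp [this]
  simp only [mul_sub, Finset.sum_sub_distrib, ← Finset.sum_mul, w.sum_weight_div_total hs hG, h1,
    one_mul]

theorem abs_average_sub_le (hs : ∀ x, 0 < s x) {h : ι → ℝ} {L : ℝ} (hL : 0 ≤ L)
    (hh : ∀ i j, |h i - h j| ≤ L * dist (c i) (c j)) (x : M) (j : ι) :
    |w.average h x - h j| ≤ L * (8 * s x + dist x (c j)) := by
  rw [w.average_sub hs h (h j) Subset.rfl]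
  calc |∑ i ∈ w.supp x, w.weight i x / w.total x * (h (w.idx i) - h j)|
      ≤ ∑ i ∈ w.supp x, |w.weight i x / w.total x * (h (w.idx i) - h j)| :=
        Finset.abs_sum_le_sum_abs _ _
    _ ≤ ∑ i ∈ w.supp x, w.weight i x / w.total x * (L * (8 * s x + dist x (c j))) := by
        refine Finset.sum_le_sum fun i _ => ?_
        have h0 : 0 ≤ w.weight i x / w.total x := div_nonneg (w.nonneg i x) (w.total_pos hs x).le
        rw [abs_mul, abs_of_nonneg h0]
        rcases eq_or_ne (w.weight i x) 0 with h | h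
        · simp [h]
        · refine mul_le_mul_of_nonneg_left ((hh _ _).trans ?_) h0
          refine mul_le_mul_of_nonneg_left ?_ hL
          have := dist_triangle_left (c (w.idx i)) (c j) x
          linarith [w.dist_le i x h]
    _ = L * (8 * s x + dist x (c j)) := by
        rw [← Finset.sum_mul, w.sum_weight_div_total hs Subset.rfl, one_mul]

/-- The normalized weights at two points differ by little in comparison with the scale. -/
theorem sum_abs_sub_le [DecidableEq I] (hs : ∀ x, 0 < s x) (x y : M) :
    ∑ i ∈ w.supp x ∪ w.supp y, |w.weight i x / w.total x - w.weight i y / w.total y| ≤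
      8 * N * dist x y / s x := by
  set G := w.supp x ∪ w.supp y with hG
  have hx : w.supp x ⊆ G := Finset.subset_union_left
  have hy : w.supp y ⊆ G := Finset.subset_union_right
  have hX := w.total_pos hs x
  have hY := w.total_pos hs y
  have hcard : (G.card : ℝ) ≤ 2 * N := by
    have := (Finset.card_union_le (w.supp x) (w.supp y)).trans
      (add_le_add (w.card_supp_le x) (w.card_supp_le y))
    rw [two_mul]; exact_mod_cast this
  have hsum : ∑ i ∈ G, |w.weight i x - w.weight i y| ≤ 2 * N * dist x y := by
    calc ∑ i ∈ G, |w.weight i x - w.weight i y| ≤ ∑ _i ∈ G, dist x y :=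
          Finset.sum_le_sum fun i _ => w.abs_sub_le i x y
      _ = G.card * dist x y := by simp
      _ ≤ 2 * N * dist x y := by gcongr
  have htot : |w.total y - w.total x| ≤ 2 * N * dist x y := by
    rw [w.total_eq_sum hx, w.total_eq_sum hy, ← Finset.sum_sub_distrib]
    refine (Finset.abs_sum_le_sum_abs _ _).trans ((le_of_eq ?_).trans hsum)
    exact Finset.sum_congr rfl fun i _ => abs_sub_comm _ _
  have hterm : ∀ i, |w.weight i x / w.total x - w.weight i y / w.total y| ≤
      |w.weight i x - w.weight i y| / w.total x +
        w.weight i y / w.total y * (|w.total y - w.total x| / w.total x) := by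
    intro i
    have e : w.weight i x / w.total x - w.weight i y / w.total y =
        (w.weight i x - w.weight i y) / w.total x +
          w.weight i y / w.total y * ((w.total y - w.total x) / w.total x) := by
      field_simp; ring
    rw [e]
    refine (abs_add_le _ _).trans_eq ?_
    rw [abs_div, abs_mul, abs_div _ (w.total x), abs_of_pos hX,
      abs_of_nonneg (div_nonneg (w.nonneg i y) hY.le)]
  calc ∑ i ∈ G, |w.weight i x / w.total x - w.weight i y / w.total y|
      ≤ ∑ i ∈ G, (|w.weight i x - w.weight i y| / w.total x +
        w.weight i y / w.total y * (|w.total y - w.total x| / w.total x)) :=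
        Finset.sum_le_sum fun i _ => hterm i
    _ = (∑ i ∈ G, |w.weight i x - w.weight i y|) / w.total x +
        |w.total y - w.total x| / w.total x := by
        rw [Finset.sum_add_distrib, ← Finset.sum_mul, w.sum_weight_div_total hs hy, one_mul,
          Finset.sum_div]
    _ ≤ 2 * N * dist x y / w.total x + 2 * N * dist x y / w.total x := by gcongr
    _ = 4 * N * dist x y / w.total x := by ring
    _ ≤ 4 * N * dist x y / (s x / 2) := by
        gcongr
        · exact half_pos (hs x)
        · exact w.le_sum x
    _ = 8 * N * dist x y / s x := by
        have := (hs x).ne'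
        field_simp; ring

/-- Averaging preserves the Lipschitz property, with a loss that depends on `N` only. If `x` and `y`
are close in comparison with the scale, this is because the normalized weights vary slowly; if not,
because the averages at `x` and at `y` are close to prescribed values at nearby points. -/
theorem abs_average_sub_average_le (hs : ∀ x, 0 < s x) (hc : ∀ x, ∃ j, dist x (c j) ≤ 8 * s x)
    {h : ι → ℝ} {L : ℝ} (hL : 0 ≤ L) (hh : ∀ i j, |h i - h j| ≤ L * dist (c i) (c j)) (x y : M) :
    |w.average h x - w.average h y| ≤ (136 * N + 49) * L * dist x y := by
  classical
  wlog hxy : s y ≤ s x generalizing x y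
  · rw [abs_sub_comm, dist_comm]
    exact this y x (le_of_not_ge hxy)
  obtain ⟨j, hj⟩ := hc x
  have hd : 0 ≤ dist x y := dist_nonneg
  have hsx := hs x
  rcases le_or_gt (dist x y) (s x) with hle | hlt
  · set G := w.supp x ∪ w.supp y with hG
    have e : w.average h x - w.average h y = ∑ i ∈ G,
        (w.weight i x / w.total x - w.weight i y / w.total y) * (h (w.idx i) - h j) := by
      simp only [sub_mul, Finset.sum_sub_distrib]
      rw [← w.average_sub hs h (h j) (Finset.subset_union_left),
        ← w.average_sub hs h (h j) (Finset.subset_union_right)]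
      ring
    rw [e]
    calc _ ≤ ∑ i ∈ G,
          |(w.weight i x / w.total x - w.weight i y / w.total y) * (h (w.idx i) - h j)| :=
          Finset.abs_sum_le_sum_abs _ _
      _ ≤ ∑ i ∈ G, |w.weight i x / w.total x - w.weight i y / w.total y| * (L * (17 * s x)) := by
          refine Finset.sum_le_sum fun i _ => ?_
          rw [abs_mul]
          by_cases h0 : w.weight i x = 0 ∧ w.weight i y = 0
          · simp [h0.1, h0.2]
          · refine mul_le_mul_of_nonneg_left ((hh _ _).trans ?_) (abs_nonneg _)
            refine mul_le_mul_of_nonneg_left ?_ hL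
            -- `dist x (c (idx i)) ≤ 8 * s x + dist x y ≤ 9 * s x` and `dist x (c j) ≤ 8 * s x`.
            have t1 := dist_triangle_left (c (w.idx i)) (c j) x
            rcases not_and_or.1 h0 with h1 | h1
            · linarith [w.dist_le i x h1]
            · have t2 := dist_triangle x y (c (w.idx i))
              linarith [w.dist_le i y h1]
      _ ≤ 8 * N * dist x y / s x * (L * (17 * s x)) := by
          rw [← Finset.sum_mul]
          exact mul_le_mul_of_nonneg_right (w.sum_abs_sub_le hs x y) (by positivity)
      _ = 136 * N * L * dist x y := by field_simp; ring
      _ ≤ (136 * N + 49) * L * dist x y := by gcongr; linarith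
  · obtain ⟨k, hk⟩ := hc y
    have h1 := w.abs_average_sub_le hs hL hh x j
    have h2 := w.abs_average_sub_le hs hL hh y k
    have h3 := hh j k
    have t1 := dist_triangle_left (c j) (c k) x
    have t2 := dist_triangle x y (c k)
    calc |w.average h x - w.average h y|
        = |(w.average h x - h j) + (h j - h k) - (w.average h y - h k)| := by ring_nf
      _ ≤ |w.average h x - h j| + |h j - h k| + |w.average h y - h k| :=
          (abs_sub _ _).trans (by gcongr; exact abs_add_le _ _)
      _ ≤ L * (8 * s x + dist x (c j)) + L * dist (c j) (c k) + L * (8 * s y + dist y (c k)) := by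
          gcongr
      _ = L * (8 * s x + dist x (c j) + dist (c j) (c k) + 8 * s y + dist y (c k)) := by ring
      _ ≤ L * (49 * dist x y) := by
          refine mul_le_mul_of_nonneg_left ?_ hL
          linarith
      _ = 49 * L * dist x y := by ring
      _ ≤ (136 * N + 49) * L * dist x y := by
          gcongr
          have : (0 : ℝ) ≤ N := N.cast_nonneg
          linarith

end ScaledWeights

/-- In a doubling space there are weights at the scale `infDist x (range c) + δ`. The index set
is the set of pairs `(k, y)` with `y` in a `2 ^ k`-net of the range of `c`; such a pair gets positive
weight at the points `x` with `2 ^ k` comparable to the scale at `x` and `y` within reach of `x`. -/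
theorem exists_scaledWeights {M : Type*} [MetricSpace M] (hD : IsDoublingSpace M) :
    ∃ N : ℕ, ∀ {ι : Type*} [Nonempty ι] (c : ι → M) {δ : ℝ}, 0 < δ →
      Nonempty (ScaledWeights c (fun x => infDist x (range c) + δ) N (ℤ × M)) := by
  classical
  obtain ⟨D, hD⟩ := hD
  refine ⟨4 * D ^ 5, fun {ι} _ c δ hδ => ?_⟩
  have h2 : ∀ k : ℤ, (0 : ℝ) < 2 ^ k := fun k => by positivity
  choose N hNc hNsep hNmax using fun k : ℤ => exists_maximal_separated (range c) (h2 k).le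
  choose t htcard ht using fun (k : ℤ) (x : M) =>
    exists_finset_of_pairwise_lt_dist hD (h2 k) (hNsep k) x
  set s : M → ℝ := fun x => infDist x (range c) + δ with hs
  have hspos : ∀ x, 0 < s x := fun x => add_pos_of_nonneg_of_pos infDist_nonneg hδ
  have hslip : ∀ x y, |s x - s y| ≤ dist x y := fun x y => by
    rw [hs, add_sub_add_right_eq_sub]
    have := (lipschitz_infDist_pt (range c)).dist_le_mul x y
    rwa [NNReal.coe_one, one_mul, Real.dist_eq] at this
  -- At `x` the weight of `(k, y)` is positive only if `2 ^ k < s x ≤ dist x y + δ < 8 * 2 ^ k`, so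
  -- at most four values of `k` occur.
  let a : ℤ × M → M → ℝ := fun i x => if i.2 ∈ N i.1 then
    max 0 (min (s x - 2 ^ i.1) (8 * 2 ^ i.1 - (dist x i.2 + δ))) else 0
  have ha : ∀ i x, a i x ≠ 0 → i.2 ∈ N i.1 ∧ 2 ^ i.1 < s x ∧ dist x i.2 + δ < 8 * 2 ^ i.1 := by
    intro i x h
    by_cases hi : i.2 ∈ N i.1
    · simp only [a, if_pos hi] at h
      have h' : 0 < min (s x - 2 ^ i.1) (8 * 2 ^ i.1 - (dist x i.2 + δ)) :=
        not_le.1 fun hle => h (max_eq_left hle)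
      exact ⟨hi, by linarith [(lt_min_iff.1 h').1], by linarith [(lt_min_iff.1 h').2]⟩
    · simp [a, if_neg hi] at h
  have hN : ∀ i : ℤ × M, i.2 ∈ N i.1 → c (Function.invFun c i.2) = i.2 := fun i hi =>
    Function.invFun_eq (hNc _ hi)
  have hnonneg : ∀ i x, 0 ≤ a i x := fun i x => by
    simp only [a]; split_ifs
    · exact le_max_left _ _
    · exact le_rfl
  let F : M → Finset (ℤ × M) := fun x =>
    (Finset.Icc (Int.log 2 (s x) - 3) (Int.log 2 (s x))).biUnion fun k => (t k x).image (Prod.mk k)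
  have hlog : ∀ x, (2 : ℝ) ^ Int.log 2 (s x) ≤ s x := fun x => by
    simpa using Int.zpow_log_le_self (b := 2) one_lt_two (hspos x)
  have hlog' : ∀ x, s x < (2 : ℝ) ^ (Int.log 2 (s x) + 1) := fun x => by
    simpa using Int.lt_zpow_succ_log_self (b := 2) one_lt_two (s x)
  have hmem : ∀ i x, a i x ≠ 0 → i ∈ F x := by
    rintro ⟨k, y⟩ x h
    obtain ⟨h1, h3, h4⟩ := ha _ _ h
    dsimp only at h1 h3 h4
    refine Finset.mem_biUnion.2 ⟨k, Finset.mem_Icc.2 ⟨?_, ?_⟩,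
      Finset.mem_image.2 ⟨y, ht k x y h1 (by linarith), rfl⟩⟩
    · -- `2 ^ log (s x) ≤ s x ≤ dist x y + δ < 2 ^ (k + 3)`
      have h5 : s x ≤ dist x y + δ := by
        have := infDist_le_dist_of_mem (x := x) (hNc k h1)
        simp only [hs]; linarith
      have h6 : (2 : ℝ) ^ Int.log 2 (s x) < 2 ^ (k + 3) := by
        rw [zpow_add₀ two_ne_zero]
        norm_num
        linarith [hlog x]
      have := (zpow_lt_zpow_iff_right₀ (one_lt_two (α := ℝ))).1 h6
      omega
    · have := (zpow_lt_zpow_iff_right₀ (one_lt_two (α := ℝ))).1 (h3.trans (hlog' x))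
      omega
  refine ⟨⟨fun i => Function.invFun c i.2, a, F, hnonneg, fun i x y => ?_, hmem, fun x => ?_,
    fun i x h => ?_, fun x => ?_⟩⟩
  · simp only [a]
    split_ifs
    · refine (abs_max_sub_max_le_max _ _ _ _).trans (max_le (by simp) ?_)
      refine (abs_min_sub_min_le_max _ _ _ _).trans (max_le ?_ ?_)
      · rw [sub_sub_sub_cancel_right]; exact hslip x y
      · rw [sub_sub_sub_cancel_left, add_sub_add_right_eq_sub, abs_sub_comm]
        exact abs_dist_sub_le x y i.2
    · simp
  · calc (F x).card
        ≤ (Finset.Icc (Int.log 2 (s x) - 3) (Int.log 2 (s x))).card * D ^ 5 :=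
          Finset.card_biUnion_le_card_mul _ _ _ fun k _ =>
            Finset.card_image_le.trans (htcard k x)
      _ = 4 * D ^ 5 := by
          rw [Int.card_Icc]
          congr 1
          omega
  · obtain ⟨h1, h3, h4⟩ := ha i x h
    rw [hN i h1]
    linarith
  · -- One single weight suffices: a net point near `x`, at the level `k` with
    -- `2 ^ (k + 1) ≤ s x < 2 ^ (k + 2)`.
    set k := Int.log 2 (s x) - 1 with hk
    have e1 : (2 : ℝ) ^ Int.log 2 (s x) = 2 * 2 ^ k := by
      rw [← zpow_one_add₀ two_ne_zero]; congr 1; omega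
    have e2 : (2 : ℝ) ^ (Int.log 2 (s x) + 1) = 4 * 2 ^ k := by
      rw [zpow_add_one₀ two_ne_zero, e1]; ring
    have l1 := hlog x
    have l2 := hlog' x
    rw [e1] at l1
    rw [e2] at l2
    obtain ⟨y', hy', hxy'⟩ := (infDist_lt_iff (range_nonempty c)).1
      (lt_add_of_pos_right (infDist x (range c)) (h2 k))
    obtain ⟨y, hy, hyy'⟩ := hNmax k y' hy'
    have hdist : dist x y + δ ≤ s x + 2 * 2 ^ k := by
      have := dist_triangle x y' y
      simp only [hs]; linarith
    have hw : s x / 2 ≤ a (k, y) x := by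
      simp only [a, if_pos hy]
      refine le_max_of_le_right (le_min ?_ ?_) <;> linarith
    have hne : a (k, y) x ≠ 0 := ((half_pos (hspos x)).trans_le hw).ne'
    exact hw.trans (Finset.single_le_sum (f := fun i => a i x) (fun i _ => hnonneg i x)
      (hmem _ _ hne))

/-- Linear extension from subsets of doubling spaces. The subset is the range of a family `c` of
points, and `ev` assigns to each `v : V` the values prescribed at these points, up to a
constant. The extension is an ultralimit of averages at the scale `infDist x (range c) + δ` as
`δ → 0`. -/
theorem exists_extension_operator {M : Type*} [MetricSpace M] (hD : IsDoublingSpace M) (o : M)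
    {ι : Type*} [Nonempty ι] (c : ι → M) {V : Type*} [NormedAddCommGroup V] [NormedSpace ℝ V]
    (ev : V →ₗ[ℝ] (ι → ℝ)) {C : ℝ} (hC : 0 ≤ C)
    (hev : ∀ v i j, |ev v i - ev v j| ≤ C * ‖v‖ * dist (c i) (c j)) :
    ∃ E : V →L[ℝ] LipZero M o, ∀ v i j, E v (c i) - E v (c j) = ev v i - ev v j := by
  obtain ⟨N, hN⟩ := exists_scaledWeights hD
  have hδ : ∀ n : ℕ, (0 : ℝ) < 1 / (n + 1) := fun n => Nat.one_div_pos_of_nat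
  let w := fun n : ℕ => (hN c (hδ n)).some
  have hs : ∀ (n : ℕ) (x : M), 0 < infDist x (range c) + 1 / ((n : ℝ) + 1) := fun n x =>
    add_pos_of_nonneg_of_pos infDist_nonneg (hδ n)
  have hc : ∀ (n : ℕ) (x : M), ∃ j,
      dist x (c j) ≤ 8 * (infDist x (range c) + 1 / ((n : ℝ) + 1)) := by
    intro n x
    obtain ⟨_, ⟨j, rfl⟩, hj⟩ := (infDist_lt_iff (range_nonempty c)).1
      (lt_add_of_pos_right (infDist x (range c)) (hδ n))
    exact ⟨j, by linarith [hs n x]⟩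
  let A := fun n : ℕ => (w n).average ∘ₗ ev
  have hA : ∀ n v x y, |A n v x - A n v y| ≤ (136 * N + 49) * (C * ‖v‖) * dist x y :=
    fun n v x y => (w n).abs_average_sub_average_le (hs n) (hc n) (by positivity) (hev v) x y
  let T : ℕ → V →ₗ[ℝ] (M → ℝ) := fun n =>
    { toFun := fun v x => A n v x - A n v o
      map_add' := fun v u => by ext x; simp only [map_add, Pi.add_apply]; ring
      map_smul' := fun a v => by
        ext x; simp only [map_smul, Pi.smul_apply, smul_eq_mul, RingHom.id_apply]; ring }
  obtain ⟨E, -, hE⟩ := exists_ultralimit_operator (o := o) T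
    (fun _ x y => (136 * N + 49) * C * dist x y) (C := (136 * N + 49) * C) (by positivity)
    (fun x y => tendsto_const_nhds)
    (fun n v x y => by
      change |(A n v x - A n v o) - (A n v y - A n v o)| ≤ _
      rw [sub_sub_sub_cancel_right]
      linarith [hA n v x y])
    (fun v => by simp [T])
  refine ⟨E, fun v i j => ?_⟩
  have hlim : ∀ i, Tendsto (fun n => A n v (c i)) (hyperfilter ℕ) (𝓝 (ev v i)) := by
    intro i
    have h1 : ∀ n, |A n v (c i) - ev v i| ≤ C * ‖v‖ * 8 * (1 / ((n : ℝ) + 1)) := fun n => by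
      have := (w n).abs_average_sub_le (hs n) (by positivity) (hev v) (c i) i
      rw [infDist_zero_of_mem (mem_range_self i), dist_self] at this
      refine this.trans_eq ?_
      ring
    have h2 : Tendsto (fun n : ℕ => C * ‖v‖ * 8 * (1 / ((n : ℝ) + 1))) atTop (𝓝 0) := by
      simpa using tendsto_one_div_add_atTop_nhds_zero_nat.const_mul (C * ‖v‖ * 8)
    have h3 := squeeze_zero_norm (a := fun n : ℕ => C * ‖v‖ * 8 * (1 / ((n : ℝ) + 1)))
      (f := fun n => A n v (c i) - ev v i) h1 h2
    exact (tendsto_sub_nhds_zero_iff.1 h3).mono_left Nat.hyperfilter_le_atTop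
  refine tendsto_nhds_unique ((hE v (c i)).sub (hE v (c j))) ?_
  refine ((hlim i).sub (hlim j)).congr fun n => ?_
  change _ = (A n v (c i) - A n v o) - (A n v (c j) - A n v o)
  ring

/-! ### Pullback operators between Lipschitz spaces -/

namespace LipZero

variable {X M : Type*} [MetricSpace X] [MetricSpace M] {p : X} {o : M} {φ : X → M} {a K : ℝ}

theorem abs_comap_sub_le (hφ : ∀ x y, |a| * dist (φ x) (φ y) ≤ K * dist x y) (f : LipZero M o)
    (x y : X) :
    |a * (f (φ x) - f (φ p)) - a * (f (φ y) - f (φ p))| ≤ K * ‖f‖ * dist x y := by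
  rw [← mul_sub, sub_sub_sub_cancel_right, abs_mul]
  calc |a| * |f (φ x) - f (φ y)| ≤ |a| * (‖f‖ * dist (φ x) (φ y)) := by
        gcongr; exact abs_sub_le f _ _
    _ = ‖f‖ * (|a| * dist (φ x) (φ y)) := by ring
    _ ≤ ‖f‖ * (K * dist x y) := mul_le_mul_of_nonneg_left (hφ x y) (norm_nonneg f)
    _ = K * ‖f‖ * dist x y := by ring

/-- The operator `f ↦ a • (f ∘ φ - f (φ p))` between Lipschitz spaces. -/
def comap (p : X) (o : M) (φ : X → M) (a K : ℝ) (hK : 0 ≤ K)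
    (hφ : ∀ x y, |a| * dist (φ x) (φ y) ≤ K * dist x y) : LipZero M o →L[ℝ] LipZero X p :=
  LinearMap.mkContinuous
    { toFun := fun f => (⟨fun x => a * (f (φ x) - f (φ p)), by simp, K * ‖f‖,
        abs_comap_sub_le hφ f⟩ : lipZeroSubmodule X p)
      map_add' := fun f g => ext_apply fun x => by
        change a * ((f + g) (φ x) - (f + g) (φ p)) =
          a * (f (φ x) - f (φ p)) + a * (g (φ x) - g (φ p))
        simp only [add_apply]; ring
      map_smul' := fun b f => ext_apply fun x => by
        change a * ((b • f) (φ x) - (b • f) (φ p)) = b * (a * (f (φ x) - f (φ p)))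
        simp only [smul_apply]; ring }
    K fun f => norm_le (mul_nonneg hK (norm_nonneg _)) (abs_comap_sub_le hφ f)

theorem norm_comap_le (hK : 0 ≤ K) (hφ : ∀ x y, |a| * dist (φ x) (φ y) ≤ K * dist x y)
    (f : LipZero M o) : ‖comap p o φ a K hK hφ f‖ ≤ K * ‖f‖ :=
  norm_le (mul_nonneg hK (norm_nonneg _)) (abs_comap_sub_le hφ f)

end LipZero

/-- The inclusion of `LipZero M o` into the space of all functions on `M`. -/
def lipZeroCoe {M : Type*} [MetricSpace M] (o : M) : LipZero M o →ₗ[ℝ] (M → ℝ) :=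
  (lipZeroSubmodule M o).subtype

/-! ### The three complementation results -/

/-- For a good pair, a function on `M` is recovered from the sequence of its restrictions
along `i n` as an ultralimit. -/
theorem IsGoodPair.isComplementedIn {X M : Type*} [MetricSpace X] [MetricSpace M] {p : X} {o : M}
    (h : IsGoodPair p o) : IsComplementedIn (LipZero M o) (ℕ →ᵇ LipZero X p) := by
  obtain ⟨r, i, K, hr, hi, hi', hp, hu⟩ := h
  choose u hu using hu
  have hφ : ∀ n x y, |r n| * dist (i n x) (i n y) ≤ |K| * dist x y := fun n x y => by
    rw [abs_of_pos (hr n)]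
    have h1 := mul_le_mul_of_nonneg_left (hi n x y) (hr n).le
    have h2 : r n * (K * rescaledDist (r n) x y) = K * dist x y := by
      have := (hr n).ne'
      simp only [rescaledDist]; field_simp
    rw [h2] at h1
    exact h1.trans (mul_le_mul_of_nonneg_right (le_abs_self K) dist_nonneg)
  let T := boundedSeqMap (fun n => LipZero.comap p o (i n) (r n) |K| (abs_nonneg K) (hφ n)) |K|
    fun n f => LipZero.norm_comap_le _ _ f
  have hb : ∀ n (g : ℕ →ᵇ LipZero X p) (x y : X),
      |(r n)⁻¹ * (g n x - g n y)| ≤ |K| * dist (i n x) (i n y) * ‖g‖ := fun n g x y => by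
    rw [abs_mul, abs_of_pos (inv_pos.2 (hr n))]
    have h0 := inv_nonneg.2 (hr n).le
    calc (r n)⁻¹ * |g n x - g n y| ≤ (r n)⁻¹ * (‖g‖ * dist x y) := by
          gcongr
          exact (LipZero.abs_sub_le _ _ _).trans
            (mul_le_mul_of_nonneg_right (g.norm_coe_le_norm n) dist_nonneg)
      _ = rescaledDist (r n) x y * ‖g‖ := by simp only [rescaledDist]; ring
      _ ≤ |K| * dist (i n x) (i n y) * ‖g‖ := by
          gcongr
          exact (hi' n x y).trans (mul_le_mul_of_nonneg_right (le_abs_self K) dist_nonneg)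
  let R : ℕ → (ℕ →ᵇ LipZero X p) →ₗ[ℝ] (M → ℝ) := fun n =>
    { toFun := fun g x => (r n)⁻¹ * g n (u x n)
      map_add' := fun f g => by
        ext x
        simp only [BoundedContinuousFunction.add_apply, LipZero.add_apply, Pi.add_apply]; ring
      map_smul' := fun a g => by
        ext x
        simp only [BoundedContinuousFunction.smul_apply, LipZero.smul_apply, Pi.smul_apply,
          smul_eq_mul, RingHom.id_apply]
        ring }
  obtain ⟨S, -, hS⟩ := exists_ultralimit_operator (o := o) R
    (fun n x y => |K| * dist (i n (u x n)) (i n (u y n))) (abs_nonneg K)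
    (fun x y => ((hu x).dist (hu y)).const_mul _)
    (fun n g x y => by
      have := hb n g (u x n) (u y n)
      rwa [mul_sub] at this)
    (fun g => by
      refine squeeze_zero_norm (a := fun n => |K| * dist (i n (u o n)) o * ‖g‖) (fun n => ?_) ?_
      · have := hb n g (u o n) p
        rwa [LipZero.apply_base, sub_zero, hp n] at this
      · have := (((hu o).dist (tendsto_const_nhds (x := o))).const_mul |K|).mul_const ‖g‖
        simpa using this)
  refine ⟨T, S, fun f => LipZero.ext_apply fun x => tendsto_nhds_unique (hS (T f) x) ?_⟩
  have hf : Tendsto (fun n => f (i n (u x n))) atTop (𝓝 (f x)) := by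
    rw [tendsto_iff_dist_tendsto_zero]
    refine squeeze_zero (fun _ => dist_nonneg)
      (fun n => (Real.dist_eq _ _).trans_le (LipZero.abs_sub_le f _ _)) ?_
    simpa using (tendsto_iff_dist_tendsto_zero.1 (hu x)).const_mul ‖f‖
  refine (hf.mono_left Nat.hyperfilter_le_atTop).congr fun n => ?_
  change _ = (r n)⁻¹ * (r n * (f (i n (u x n)) - f (i n p)))
  rw [hp n, LipZero.apply_base, sub_zero, inv_mul_cancel_left₀ (hr n).ne']

/-- Restriction from `M` to `X`, corrected by a constant to vanish at the base point of `X`. -/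
def LipZero.restrictSet {M : Type*} [MetricSpace M] (X : Set M) (p : X) (o : M) :
    LipZero M o →L[ℝ] LipZero X p :=
  LipZero.comap p o Subtype.val 1 1 zero_le_one fun x y => by simp [Subtype.dist_eq]

theorem LipZero.restrictSet_apply {M : Type*} [MetricSpace M] (X : Set M) (p : X) (o : M)
    (f : LipZero M o) (x : X) : LipZero.restrictSet X p o f x = f x - f p :=
  one_mul _

theorem IsDoublingSpace.isComplementedIn_subset {M : Type*} [MetricSpace M]
    (hD : IsDoublingSpace M) (o : M) (X : Set M) (p : X) :
    IsComplementedIn (LipZero X p) (LipZero M o) := by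
  have : Nonempty X := ⟨p⟩
  obtain ⟨E, hE⟩ := exists_extension_operator hD o (Subtype.val : X → M) (lipZeroCoe p)
    zero_le_one fun v x y => by rw [one_mul]; exact LipZero.abs_sub_le v x y
  refine ⟨E, LipZero.restrictSet X p o, fun f => LipZero.ext_apply fun x => ?_⟩
  rw [LipZero.restrictSet_apply, hE f x p]
  change f x - f p = f x
  rw [LipZero.apply_base, sub_zero]

/-- If `X` contains scaled copies `φ j` of itself, far apart from each other on the balls of radius
`j` about the base point, then bounded sequences in `LipZero X p` embed as a complemented subspace
of `LipZero X p`: the `k`-th term of a sequence is put on the copies of larger and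
larger balls with indices `Nat.pair k n`, and is recovered from them as an ultralimit. -/
theorem isComplementedIn_seq_of_separated_copies {M : Type*} [MetricSpace M]
    (hD : IsDoublingSpace M) (X : Set M) (p : X) (φ : ℕ → X → X) (s : ℕ → ℝ) (hs : ∀ j, 0 < s j)
    (hφ : ∀ j x y, dist (φ j x) (φ j y) = s j * dist x y)
    (hsep : ∀ i j : ℕ, i < j → ∀ x y, dist x p ≤ i → dist y p ≤ j →
      s i * dist x p + s j * dist y p ≤ 3 * dist (φ i x) (φ j y)) :
    IsComplementedIn (ℕ →ᵇ LipZero X p) (LipZero X p) := by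
  -- `(j, x) : ι` stands for the point `φ j x`. A point may have several such names (such as `p` if
  -- all `φ j` fix it); the Lipschitz estimate for `ev` makes the values there agree.
  let ι := {a : ℕ × X // dist a.2 p ≤ a.1}
  have : Nonempty ι := ⟨⟨(0, p), by simp⟩⟩
  let ev : (ℕ →ᵇ LipZero X p) →ₗ[ℝ] (ι → ℝ) :=
    { toFun := fun g a => s a.1.1 * g a.1.1.unpair.1 a.1.2
      map_add' := fun f g => by
        ext a
        simp only [BoundedContinuousFunction.add_apply, LipZero.add_apply, Pi.add_apply]; ring
      map_smul' := fun b g => by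
        ext a
        simp only [BoundedContinuousFunction.smul_apply, LipZero.smul_apply, Pi.smul_apply,
          smul_eq_mul, RingHom.id_apply]
        ring }
  have hg : ∀ (g : ℕ →ᵇ LipZero X p) j k (x y : X),
      |s j * (g k x - g k y)| ≤ ‖g‖ * (s j * dist x y) := fun g j k x y => by
    rw [abs_mul, abs_of_pos (hs j)]
    calc s j * |g k x - g k y| ≤ s j * (‖g‖ * dist x y) := by
          refine mul_le_mul_of_nonneg_left ?_ (hs j).le
          exact (LipZero.abs_sub_le _ _ _).trans
            (mul_le_mul_of_nonneg_right (g.norm_coe_le_norm k) dist_nonneg)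
      _ = ‖g‖ * (s j * dist x y) := by ring
  have hg₀ : ∀ (g : ℕ →ᵇ LipZero X p) j k (x : X), |s j * g k x| ≤ ‖g‖ * (s j * dist x p) :=
    fun g j k x => by
      have := hg g j k x p
      rwa [LipZero.apply_base, sub_zero] at this
  have hsep' : ∀ i j : ℕ, i ≠ j → ∀ x y, dist x p ≤ i → dist y p ≤ j →
      s i * dist x p + s j * dist y p ≤ 3 * dist (φ i x) (φ j y) := by
    intro i j hij x y hx hy
    rcases hij.lt_or_gt with h | h
    · exact hsep i j h x y hx hy
    · rw [dist_comm (φ i x), add_comm]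
      exact hsep j i h y x hy hx
  obtain ⟨E, hE⟩ := exists_extension_operator hD (p : M) (fun a : ι => (φ a.1.1 a.1.2 : M)) ev
    (C := 3) (by norm_num) (by
      rintro g ⟨⟨i, x⟩, hx⟩ ⟨⟨j, y⟩, hy⟩
      change |s i * g i.unpair.1 x - s j * g j.unpair.1 y| ≤ 3 * ‖g‖ * dist (φ i x) (φ j y)
      rcases eq_or_ne i j with rfl | hij
      · rw [← mul_sub, hφ]
        refine (hg g i _ x y).trans ?_
        have : 0 ≤ ‖g‖ * (s i * dist x y) :=
          mul_nonneg (norm_nonneg _) (mul_nonneg (hs i).le dist_nonneg)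
        linarith
      · calc |s i * g i.unpair.1 x - s j * g j.unpair.1 y|
            ≤ |s i * g i.unpair.1 x| + |s j * g j.unpair.1 y| := abs_sub _ _
          _ ≤ ‖g‖ * (s i * dist x p) + ‖g‖ * (s j * dist y p) := add_le_add (hg₀ ..) (hg₀ ..)
          _ = ‖g‖ * (s i * dist x p + s j * dist y p) := by ring
          _ ≤ ‖g‖ * (3 * dist (φ i x) (φ j y)) :=
              mul_le_mul_of_nonneg_left (hsep' i j hij x y hx hy) (norm_nonneg _)
          _ = 3 * ‖g‖ * dist (φ i x) (φ j y) := by ring)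
  have hψ : ∀ j x y, |(s j)⁻¹| * dist (φ j x) (φ j y) ≤ 1 * dist x y := fun j x y => by
    rw [hφ, abs_of_pos (inv_pos.2 (hs j)), inv_mul_cancel_left₀ (hs j).ne', one_mul]
  let Q := fun j => LipZero.comap p p (φ j) (s j)⁻¹ 1 zero_le_one (hψ j)
  choose R hR hRlim using fun k => exists_ultralimit_operator (o := p)
    (fun n => lipZeroCoe p ∘ₗ (Q (Nat.pair k n) : LipZero X p →ₗ[ℝ] LipZero X p))
    (fun _ x y => 1 * dist x y) zero_le_one
    (fun x y => tendsto_const_nhds)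
    (fun n f x y => by
      refine (LipZero.abs_sub_le (Q (Nat.pair k n) f) x y).trans ?_
      have : ‖Q (Nat.pair k n) f‖ ≤ 1 * ‖f‖ :=
        LipZero.norm_comap_le zero_le_one (hψ (Nat.pair k n)) f
      rw [one_mul] at this
      simp only [one_mul]
      rw [mul_comm (dist x y)]
      exact mul_le_mul_of_nonneg_right this dist_nonneg)
    (fun f => tendsto_const_nhds.congr fun n => (LipZero.apply_base (Q (Nat.pair k n) f)).symm)
  refine ⟨(LipZero.restrictSet X p (p : M)).comp E, boundedSeqMap R 1 hR, fun g => ?_⟩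
  ext k
  refine LipZero.ext_apply fun x => tendsto_nhds_unique (hRlim k _ x) ?_
  -- From some `n` on, `x` lies in the ball of radius `Nat.pair k n ≥ n`.
  refine (tendsto_const_nhds.congr' ?_).mono_left Nat.hyperfilter_le_atTop
  filter_upwards [eventually_ge_atTop ⌈dist x p⌉₊] with n hn
  have hx : dist x p ≤ (Nat.pair k n : ℕ) :=
    (Nat.le_ceil _).trans (Nat.cast_le.2 (hn.trans (Nat.right_le_pair k n)))
  set j := Nat.pair k n with hj
  have h1 : E g (φ j x) - E g (φ j p) = s j * g k x - s j * g k p := by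
    have := hE g ⟨(j, x), hx⟩ ⟨(j, p), by simp⟩
    change _ = s j * g j.unpair.1 x - s j * g j.unpair.1 p at this
    have hk : j.unpair.1 = k := by rw [hj, Nat.unpair_pair]
    rwa [hk] at this
  change g k x = (s j)⁻¹ * (LipZero.restrictSet X p (p : M) (E g) (φ j x) -
    LipZero.restrictSet X p (p : M) (E g) (φ j p))
  rw [LipZero.restrictSet_apply, LipZero.restrictSet_apply, sub_sub_sub_cancel_right, h1,
    LipZero.apply_base, mul_zero, sub_zero, inv_mul_cancel_left₀ (hs j).ne']

/-! ### Separated copies -/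

theorem exists_seq_of_forall_exists_lt {α : Type*} [Nonempty α] (R : ℕ → ℕ → α → α → Prop)
    (h : ∀ j (f : ℕ → α), ∃ y, ∀ i < j, R i j (f i) y) :
    ∃ f : ℕ → α, ∀ i j, i < j → R i j (f i) (f j) := by
  classical
  choose g hg using h
  let step : (j : ℕ) → ((i : ℕ) → i < j → α) → α := fun j ih =>
    g j fun i => if hi : i < j then ih i hi else Classical.arbitrary α
  refine ⟨WellFounded.fix (r := (· < ·)) wellFounded_lt step, fun i j hij => ?_⟩
  rw [WellFounded.fix_eq _ step j]
  have := hg j (fun i => if i < j then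
    WellFounded.fix (r := (· < ·)) wellFounded_lt step i else Classical.arbitrary α) i hij
  rw [if_pos hij] at this
  exact this

/-- For a uniformly discrete `X` with a self-embedding of scaling factor `lam > 1` the separated
copies are images under iterates of that embedding: they fill annuli about the base point. -/
theorem isComplementedIn_seq_of_isScaleClosed {M : Type*} [MetricSpace M]
    (hD : IsDoublingSpace M) (X : Set M) (p : X) (hX : IsUniformlyDiscrete X) {lam : ℝ}
    (hlam : 1 < lam) (h : IsScaleClosed p lam) :
    IsComplementedIn (ℕ →ᵇ LipZero X p) (LipZero X p) := by
  obtain ⟨ε, hε, hX⟩ := hX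
  obtain ⟨ψ, hψ, hψp⟩ := h
  have hlam0 : 0 < lam := zero_lt_one.trans hlam
  have hψ' : ∀ x y, dist (ψ x) (ψ y) = lam * dist x y := fun x y => by
    rw [← hψ x y, rescaledDist, mul_div_cancel₀ _ hlam0.ne']
  have hiter : ∀ m x y, dist (ψ^[m] x) (ψ^[m] y) = lam ^ m * dist x y := by
    intro m
    induction m with
    | zero => simp
    | succ m ih => intro x y; rw [Function.iterate_succ_apply, Function.iterate_succ_apply, ih,
        hψ', pow_succ, mul_assoc]
  have hfix : ∀ m, ψ^[m] p = p := fun m => Function.iterate_fixed hψp m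
  -- Each annulus begins at twice the outer radius of all the earlier ones.
  obtain ⟨m, hm⟩ := exists_seq_of_forall_exists_lt
    (fun i _ a b : ℕ => 2 * (lam ^ a * i) ≤ lam ^ b * ε) (by
      intro j f
      obtain ⟨b, hb⟩ := pow_unbounded_of_one_lt
        ((∑ i ∈ Finset.range j, 2 * (lam ^ f i * i)) / ε) hlam
      refine ⟨b, fun i hi => ?_⟩
      refine le_trans ?_ ((div_lt_iff₀ hε).1 hb).le
      exact Finset.single_le_sum (f := fun i : ℕ => 2 * (lam ^ f i * (i : ℝ)))
        (fun i _ => by positivity) (Finset.mem_range.2 hi))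
  refine isComplementedIn_seq_of_separated_copies hD X p (fun j => ψ^[m j]) (fun j => lam ^ m j)
    (fun j => by positivity) (fun j => hiter (m j)) fun i j hij x y hx hy => ?_
  have hxp : dist (ψ^[m i] x) p = lam ^ m i * dist x p := by
    rw [← hiter, hfix]
  have hyp : dist (ψ^[m j] y) p = lam ^ m j * dist y p := by
    rw [← hiter, hfix]
  rcases eq_or_ne y p with rfl | hne
  · rw [hfix, dist_self, mul_zero, add_zero, ← hxp]
    linarith [dist_nonneg (x := ψ^[m i] x) (y := y)]
  · have h1 : 2 * (lam ^ m i * dist x p) ≤ lam ^ m j * dist y p := by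
      calc 2 * (lam ^ m i * dist x p) ≤ 2 * (lam ^ m i * i) := by gcongr
        _ ≤ lam ^ m j * ε := hm i j hij
        _ ≤ lam ^ m j * dist y p := by gcongr; exact hX y p hne
    have h2 := dist_triangle_left (ψ^[m j] y) p (ψ^[m i] x)
    rw [hxp, hyp] at h2
    linarith

/-- For a homogeneous unbounded `X` the separated copies are the images under isometries that move
the base point far away. -/
theorem isComplementedIn_seq_of_isHomogeneousSpace {M : Type*} [MetricSpace M]
    (hD : IsDoublingSpace M) (X : Set M) (p : X) (hX : IsHomogeneousSpace X)
    (hb : ¬ Bornology.IsBounded X) :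
    IsComplementedIn (ℕ →ᵇ LipZero X p) (LipZero X p) := by
  have hfar : ∀ B : ℝ, ∃ x : X, B < dist x p := by
    intro B
    by_contra! hcon
    exact hb ((isBounded_iff_subset_closedBall (p : M)).2 ⟨B, fun x hx => hcon ⟨x, hx⟩⟩)
  have : Nonempty X := ⟨p⟩
  obtain ⟨f, hf⟩ := exists_seq_of_forall_exists_lt
    (fun i j (a b : X) => 2 * ((i : ℝ) + j) ≤ dist a b) (by
      intro j f
      obtain ⟨b, hb⟩ := hfar (∑ i ∈ Finset.range j, (dist (f i) p + 2 * ((i : ℝ) + j)))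
      refine ⟨b, fun i hi => ?_⟩
      have h1 := Finset.single_le_sum (f := fun i : ℕ => dist (f i) p + 2 * ((i : ℝ) + j))
        (fun i _ => by positivity) (Finset.mem_range.2 hi)
      have h2 := dist_triangle_left b p (f i)
      linarith)
  choose e he using fun j => hX p (f j)
  refine isComplementedIn_seq_of_separated_copies hD X p (fun j => e j) (fun _ => 1)
    (fun _ => one_pos) (fun j x y => by rw [(e j).dist_eq, one_mul]) fun i j hij x y hx hy => ?_
  have h1 : dist (e i x) (f i) = dist x p := by rw [← he i, (e i).dist_eq]
  have h2 : dist (e j y) (f j) = dist y p := by rw [← he j, (e j).dist_eq]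
  have h3 := hf i j hij
  have h4 := dist_triangle4_left (e i x) (e j y) (f i) (f j)
  have h5 : 0 ≤ dist (e i x) (e j y) := dist_nonneg
  linarith

end

theorem mainTheorem8 {M : Type*} [MetricSpace M] (o : M)
    (hM : IsHomogeneousSpace M) (hD : IsDoublingSpace M)
    (X : Set M) (p : X) (hgood : IsGoodPair p o)
    (hX : (IsUniformlyDiscrete X ∧ ∃ lam : ℝ, 1 < lam ∧ IsScaleClosed p lam) ∨
      (IsHomogeneousSpace X ∧ ¬ Bornology.IsBounded X)) :
    Nonempty (LipZero M o ≃L[ℝ] LipZero X p) := by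
  have hXM : IsComplementedIn (LipZero X p) (LipZero M o) := hD.isComplementedIn_subset o X p
  refine nonempty_equiv_of_isComplementedIn_seq ?_ hXM hgood.isComplementedIn
  rcases hX with ⟨hdisc, lam, hlam, hcl⟩ | ⟨hhom, hunb⟩
  · exact isComplementedIn_seq_of_isScaleClosed hD X p hdisc hlam hcl
  · exact isComplementedIn_seq_of_isHomogeneousSpace hD X p hhom hunb
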